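/- **Setting.** A network has $L$ links; link $l$ has a transmitter with $L_{T_l}$ antennas and a receiver with $L_{R_l}$ antennas. Let $\mathbf{H}_{l,k}\in\mathbb{C}^{L_{R_l}\times L_{T_k}}$ be the channel matrices and $\mathbf{\Phi}\in\{0,1\}^{L\times L}$ a coupling matrix with zero diagonal. For input covariance matrices $\mathbf{\Sigma}_{1:L}$ of the forward links ($\mathbf{\Sigma}_l\in\mathbb{C}^{L_{T_l}\times L_{T_l}}$) and $\hat{\mathbf{\Sigma}}_{1:L}$ of the reverse links ($\hat{\mathbf{\Sigma}}_l\in\mathbb{C}^{L_{R_l}\times L_{R_l}}$), all positive semidefinite, put $$\mathbf{\Omega}_l=\mathbf{I}+\sum_{k}\mathbf{\Phi}_{l,k}\mathbf{H}_{l,k}\mathbf{\Sigma}_k\mathbf{H}_{l,k}^\dagger,\qquad \hat{\mathbf{\Omega}}_l=\mathbf{I}+\sum_{k}\mathbf{\Phi}_{k,l}\mathbf{H}_{k,l}^\dagger\hat{\mathbf{\Sigma}}_k\mathbf{H}_{k,l}.$$ The reverse network has channel matrices $\mathbf{H}_{k,l}^\dagger$ (from link $k$ to link $l$) and coupling matrix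 $\mathbf{\Phi}^T$. **Covariance transformation.** Take a decomposition into streams $\mathbf{\Sigma}_l=\sum_{m=1}^{M_l}p_{l,m}\mathbf{t}_{l,m}\mathbf{t}_{l,m}^\dagger$ with $p_{l,m}\ge 0$, $\|\mathbf{t}_{l,m}\|=1$. Let $$\mathbf{r}_{l,m}=\alpha_{l,m}\Big(\sum_{i>m}\mathbf{H}_{l,l}p_{l,i}\mathbf{t}_{l,i}\mathbf{t}_{l,i}^\dagger\mathbf{H}_{l,l}^\dagger+\mathbf{\Omega}_l\Big)^{-1}\mathbf{H}_{l,l}\mathbf{t}_{l,m},\qquad \|\mathbf{r}_{l,m}\|=1,\ \alpha_{l,m}>0$$ (with $\mathbf{r}_{l,m}=0$ if $\mathbf{H}_{l,l}\mathbf{t}_{l,m}=0$). Let $\mathbf{\Psi}_{l,m}^{k,n}$ be $0$ if $k=l$, $n\le m$; $|\mathbf{r}_{l,m}^\dagger\mathbf{H}_{l,l}\mathbf{t}_{l,n}|^2$ if $k=l$, $n>m$; and $\mathbf{\Phi}_{l,k}|\mathbf{r}_{l,m}^\dagger\mathbf{H}_{l,k}\mathbf{t}_{k,n}|^2$ if $k\neq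 l$. Let $$\gamma_{l,m}=\frac{p_{l,m}|\mathbf{r}_{l,m}^\dagger\mathbf{H}_{l,l}\mathbf{t}_{l,m}|^2}{1+\sum_{k,n}p_{k,n}\mathbf{\Psi}_{l,m}^{k,n}},$$ and let $\mathbf{D}$ be the diagonal matrix with entries $\gamma_{l,m}/|\mathbf{r}_{l,m}^\dagger\mathbf{H}_{l,l}\mathbf{t}_{l,m}|^2$ (read as $0$ if the denominator vanishes). The reverse powers are $\mathbf{q}=(\mathbf{D}^{-1}-\mathbf{\Psi}^T)^{-1}\mathbf{1}$, written $\mathbf{q}=(\mathbf{I}-\mathbf{D}\mathbf{\Psi}^T)^{-1}\mathbf{D}\mathbf{1}$ so that streams with $\gamma_{l,m}=0$ (which get $q_{l,m}=0$) are covered. The covariance transformation maps $\mathbf{\Sigma}_{1:L}$, through this decomposition, to the dual input covariance matrices $\hat{\mathbf{\Sigma}}_l=\sum_{m}q_{l,m}\mathbf{r}_{l,m}\mathbf{r}_{l,m}^\dagger$. **Polite water-filling.** Given $\mathbf{\Sigma}_{1:L}$ and a dual $\hat{\mathbf{\Sigma}}_{1:L}$, a number $\nu_l\ge0$ is a water-filling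 level of link $l$ if, for a thin singular value decomposition $\mathbf{\Omega}_l^{-1/2}\mathbf{H}_{l,l}\hat{\mathbf{\Omega}}_l^{-1/2}=\mathbf{F}_l\mathbf{\Delta}_l\mathbf{G}_l^\dagger$ (with $\mathbf{F}_l^\dagger\mathbf{F}_l=\mathbf{G}_l^\dagger\mathbf{G}_l=\mathbf{I}$ and $\mathbf{\Delta}_l$ a positive diagonal matrix of size $\operatorname{rank}\mathbf{H}_{l,l}$), $$\hat{\mathbf{\Omega}}_l^{1/2}\mathbf{\Sigma}_l\hat{\mathbf{\Omega}}_l^{1/2}=\mathbf{G}_l\left(\nu_l\mathbf{I}-\mathbf{\Delta}_l^{-2}\right)^+\mathbf{G}_l^\dagger .$$ $\mathbf{\Sigma}_{1:L}$ possesses the polite water-filling structure if, with the dual $\hat{\mathbf{\Sigma}}_{1:L}$ obtained from some decomposition of $\mathbf{\Sigma}_{1:L}$, every link has a water-filling level. **Theorem.** Suppose that $\mathbf{\Sigma}_{1:L}$ possesses the polite water-filling structure. Then the covariance transformation is unique: there is $\hat{\mathbf{\Sigma}}_{1:L}$ such that every decomposition of $\mathbf{\Sigma}_{1:L}$ is transformed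 to $\hat{\mathbf{\Sigma}}_{1:L}$; and vice versa, the covariance transformation of the reverse network transforms every decomposition of $\hat{\mathbf{\Sigma}}_{1:L}$ to $\mathbf{\Sigma}_{1:L}$. Furthermore, for $l=1,\dots,L$, $$\hat{\mathbf{\Omega}}_l^{-1}\mathbf{H}_{l,l}^\dagger\hat{\mathbf{\Sigma}}_l\mathbf{H}_{l,l}=\mathbf{\Sigma}_l\mathbf{H}_{l,l}^\dagger\mathbf{\Omega}_l^{-1}\mathbf{H}_{l,l},$$ and link $l$ has a water-filling level with respect to $\hat{\mathbf{\Sigma}}_{1:L}$, every such level $\nu_l$ satisfying $$\hat{\mathbf{\Sigma}}_l=\nu_l\left(\mathbf{\Omega}_l^{-1}-\left(\mathbf{H}_{l,l}\mathbf{\Sigma}_l\mathbf{H}_{l,l}^\dagger+\mathbf{\Omega}_l\right)^{-1}\right).$$ -/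

import Mathlib

open scoped MatrixOrder

/-- A B-MAC network with `L` links. Link `l` has a (virtual) transmitter with `nT l` antennas and a
(virtual) receiver with `nR l` antennas, `H l k` is the channel matrix from the transmitter of link
`k` to the receiver of link `l`, and `Φ` is the coupling matrix: `Φ l k = 1` if the signal of link
`k` remains as interference in link `l`, and `Φ l k = 0` otherwise. -/
structure BMAC (L : ℕ) where
  nT : Fin L → ℕ
  nR : Fin L → ℕ
  H : ∀ l k : Fin L, Matrix (Fin (nR l)) (Fin (nT k)) ℂ
  Φ : Matrix (Fin L) (Fin L) ℝ
  coupling_zero_or_one : ∀ l k, Φ l k = 0 ∨ Φ l k = 1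
  coupling_self : ∀ l, Φ l l = 0

namespace BMAC

variable {L : ℕ}

/-- The reverse links: directions are reversed, channel matrices are replaced by their conjugate
transposes, and the coupling matrix is transposed. -/
def reverse (N : BMAC L) : BMAC L where
  nT := N.nR
  nR := N.nT
  H := fun l k => (N.H k l).conjTranspose
  Φ := N.Φ.transpose
  coupling_zero_or_one := fun l k => N.coupling_zero_or_one k l
  coupling_self := fun l => N.coupling_self l

/-- Families `Σ_{1:L}` of square matrices of the sizes of the transmit antenna arrays. -/
abbrev TxFamily (N : BMAC L) : Type :=
  ∀ l : Fin L, Matrix (Fin (N.nT l)) (Fin (N.nT l)) ℂ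

/-- Families `Σ̂_{1:L}` of square matrices of the sizes of the receive antenna arrays
(the inputs of the reverse links). -/
abbrev RxFamily (N : BMAC L) : Type :=
  ∀ l : Fin L, Matrix (Fin (N.nR l)) (Fin (N.nR l)) ℂ

/-- Interference-plus-noise covariance matrix
`Ω_l = I + ∑_k Φ_{l,k} H_{l,k} Σ_k H_{l,k}†` of link `l`. -/
noncomputable def omega (N : BMAC L) (S : N.TxFamily) : N.RxFamily :=
  fun l => 1 + ∑ k, (N.Φ l k : ℂ) • (N.H l k * S k * (N.H l k).conjTranspose)

/-- Interference-plus-noise covariance matrix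
`Ω̂_l = I + ∑_k Φ_{k,l} H_{k,l}† Σ̂_k H_{k,l}` of reverse link `l`. -/
noncomputable def omegaHat (N : BMAC L) (Shat : N.RxFamily) : N.TxFamily :=
  fun l => 1 + ∑ k, (N.Φ k l : ℂ) • ((N.H k l).conjTranspose * Shat k * N.H k l)

theorem omegaHat_eq_omega_reverse (N : BMAC L) (Shat : N.RxFamily) :
    N.omegaHat Shat = N.reverse.omega Shat := by
  funext l
  simp only [omegaHat, omega, reverse, Matrix.transpose_apply, Matrix.conjTranspose_conjTranspose]
  rfl

/-- A decomposition of the input covariance matrices into data streams: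
`Σ_l = ∑_m p_{l,m} t_{l,m} t_{l,m}†` with `‖t_{l,m}‖ = 1` and `p_{l,m} ≥ 0`. -/
structure Decomposition (N : BMAC L) (S : N.TxFamily) where
  M : Fin L → ℕ
  p : ∀ l, Fin (M l) → ℝ
  t : ∀ l, Fin (M l) → (Fin (N.nT l) → ℂ)
  p_nonneg : ∀ l m, 0 ≤ p l m
  t_unit : ∀ l m, ‖WithLp.toLp 2 (t l m)‖ = 1
  sum_eq : ∀ l, S l = ∑ m, (p l m : ℂ) • Matrix.vecMulVec (t l m) (star (t l m))

namespace Decomposition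

variable {N : BMAC L} {S : N.TxFamily} (d : Decomposition N S)

/-- The set of all streams `(l, m)` of the network. -/
abbrev Stream : Type := Σ l : Fin L, Fin (d.M l)

/-- The MMSE-SIC filter before normalization,
`(∑_{i > m} H_{l,l} p_{l,i} t_{l,i} t_{l,i}† H_{l,l}† + Ω_l)⁻¹ H_{l,l} t_{l,m}`. -/
noncomputable def mmse (l : Fin L) (m : Fin (d.M l)) : Fin (N.nR l) → ℂ :=
  ((∑ i ∈ Finset.Ioi m, (d.p l i : ℂ) •
      (N.H l l * Matrix.vecMulVec (d.t l i) (star (d.t l i)) * (N.H l l).conjTranspose))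
    + N.omega S l)⁻¹.mulVec ((N.H l l).mulVec (d.t l m))

/-- The MMSE-SIC receive vector `r_{l,m}`, normalized to `‖r_{l,m}‖ = 1`
(it is `0` if `H_{l,l} t_{l,m} = 0`). -/
noncomputable def r (l : Fin L) (m : Fin (d.M l)) : Fin (N.nR l) → ℂ :=
  ((‖WithLp.toLp 2 (d.mmse l m)‖⁻¹ : ℝ) : ℂ) • d.mmse l m

/-- `|r_{l,m}† H_{l,k} t_{k,n}|²`, where `a = (l, m)` and `b = (k, n)`. -/
noncomputable def gain (a b : d.Stream) : ℝ :=
  ‖star (d.r a.1 a.2) ⬝ᵥ (N.H a.1 b.1).mulVec (d.t b.1 b.2)‖ ^ 2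

/-- The cross-talk matrix `Ψ`; its `(a, b)` entry is the interference power, at unit transmit
power, from stream `b = (k, n)` to stream `a = (l, m)`. -/
noncomputable def crossTalk : Matrix d.Stream d.Stream ℝ := fun a b =>
  if a.1 = b.1 then (if (b.2 : ℕ) ≤ (a.2 : ℕ) then 0 else d.gain a b)
  else N.Φ a.1 b.1 * d.gain a b

/-- The forward SINR `γ_{l,m}` of a stream. -/
noncomputable def sinr (a : d.Stream) : ℝ :=
  d.p a.1 a.2 * d.gain a a / (1 + ∑ b : d.Stream, d.p b.1 b.2 * d.crossTalk a b)

/-- The diagonal matrix `D` with entries `γ_{l,m} / |r_{l,m}† H_{l,l} t_{l,m}|²`. -/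
noncomputable def diagD : Matrix d.Stream d.Stream ℝ :=
  Matrix.diagonal fun a => d.sinr a / d.gain a a

/-- The transmit powers `q` of the reverse links, `q = (I - D Ψᵀ)⁻¹ D 1`, the solution of
`|r_{l,m}† H_{l,l} t_{l,m}|² q_{l,m} = γ_{l,m} (1 + ∑_{k,n} q_{k,n} Ψ_{k,n}^{l,m})`.
If all streams have positive SINR, this is `q = (D⁻¹ - Ψᵀ)⁻¹ 1`
(see `q_eq_of_sinr_pos`); streams without signal power get `q_{l,m} = 0`. -/
noncomputable def q : d.Stream → ℝ :=
  (1 - d.diagD * d.crossTalk.transpose)⁻¹.mulVec (d.diagD.mulVec 1)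

theorem q_eq_of_sinr_pos (h : ∀ a, 0 < d.sinr a) :
    d.q = (d.diagD⁻¹ - d.crossTalk.transpose)⁻¹.mulVec 1 := by
  have hg : ∀ a, d.sinr a / d.gain a a ≠ 0 := by
    intro a
    have h1 := (h a).ne'
    have h2 : d.gain a a ≠ 0 := by
      intro h0
      apply h1
      simp [sinr, h0]
    exact div_ne_zero h1 h2
  have hu : IsUnit d.diagD.det := by
    rw [diagD, Matrix.det_diagonal, isUnit_iff_ne_zero]
    exact Finset.prod_ne_zero_iff.mpr fun a _ => hg a
  have key : d.diagD⁻¹ - d.crossTalk.transpose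
      = d.diagD⁻¹ * (1 - d.diagD * d.crossTalk.transpose) := by
    rw [Matrix.mul_sub, Matrix.mul_one, ← Matrix.mul_assoc, Matrix.nonsing_inv_mul _ hu,
      Matrix.one_mul]
  rw [key, Matrix.mul_inv_rev, Matrix.nonsing_inv_nonsing_inv _ hu, q, Matrix.mulVec_mulVec]

/-- The covariance transformation: the dual input covariance matrices
`Σ̂_l = ∑_m q_{l,m} r_{l,m} r_{l,m}†` obtained from the decomposition `d` of `Σ_{1:L}`. -/
noncomputable def dual : N.RxFamily := fun l =>
  ∑ m : Fin (d.M l), (d.q ⟨l, m⟩ : ℂ) • Matrix.vecMulVec (d.r l m) (star (d.r l m))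

end Decomposition

/-- `ν` is a water-filling level for link `l`, given `Σ_{1:L}` and `Σ̂_{1:L}`: there is a thin SVD
`Ω_l^{-1/2} H_{l,l} Ω̂_l^{-1/2} = F Δ G†` such that
`Ω̂_l^{1/2} Σ_l Ω̂_l^{1/2} = G (ν I - Δ⁻²)⁺ G†`. -/
def IsWaterLevel (N : BMAC L) (S : N.TxFamily) (Shat : N.RxFamily) (l : Fin L) (ν : ℝ) : Prop :=
  0 ≤ ν ∧
  ∃ (F : Matrix (Fin (N.nR l)) (Fin (N.H l l).rank) ℂ)
    (G : Matrix (Fin (N.nT l)) (Fin (N.H l l).rank) ℂ)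
    (δ : Fin (N.H l l).rank → ℝ),
    F.conjTranspose * F = 1 ∧ G.conjTranspose * G = 1 ∧ (∀ i, 0 < δ i) ∧
    (CFC.sqrt (N.omega S l))⁻¹ * N.H l l * (CFC.sqrt (N.omegaHat Shat l))⁻¹
      = F * Matrix.diagonal (fun i => (δ i : ℂ)) * G.conjTranspose ∧
    CFC.sqrt (N.omegaHat Shat l) * S l * CFC.sqrt (N.omegaHat Shat l)
      = G * Matrix.diagonal (fun i => ((max (ν - (δ i ^ 2)⁻¹) 0 : ℝ) : ℂ)) * G.conjTranspose

/-- `Σ_{1:L}` possesses the polite water-filling structure: with the dual input covariance matrices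
produced by the covariance transformation (from some decomposition of `Σ_{1:L}`), each link has the
water-filling structure over its equivalent channel. -/
def HasPoliteWaterFilling (N : BMAC L) (S : N.TxFamily) : Prop :=
  ∃ d : Decomposition N S, ∀ l, ∃ ν : ℝ, N.IsWaterLevel S d.dual l ν

end BMAC

/-!
Fix a link with channel `H` and noise covariances `Ω` and `Ω̂` of the link and its reverse, and let
`X₀ = H Σ H† + Ω` be the covariance of the received signal. Two facts carry the proof.

The first is algebra over the singular value decomposition `Ω^{-1/2} H Ω̂^{-1/2} = F Δ G†`: if `Σ`
is water-filling at level `ν`, then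

* `Ω̂ Σ = ν H† X₀⁻¹ H Σ`, the stationarity condition (`Matrix.IsWaterFilling.stationary`);
* `ν (Ω⁻¹ - X₀⁻¹) = Ω^{-1/2} F (ν - Δ⁻²)⁺ F† Ω^{-1/2}`, which is water-filling for the reverse link
  at the same level (`Matrix.IsWaterFilling.reverse`); doing this twice returns `Σ`
  (`Matrix.IsWaterFilling.cov_eq_reverse_dual`).

The second concerns an arbitrary decomposition into streams. Removing the streams of the link one
after the other from `X₀` changes the inverse by rank-one terms along the receive vectors
`r_{l,m}` (Sherman-Morrison), so `ν (Ω⁻¹ - X₀⁻¹) = ∑ c_m r_m r_m†` with explicit `c_m`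
(`levelPower`, `sum_levelPower`). Under the stationarity condition these `c_m` satisfy the equation
that defines the reverse powers (`levelPower_eq`).

For the decomposition whose dual gives the water-filling structure, `Ω̂` is already known, and the
power equation of each link is then triangular in its streams; hence `q = c`, and the dual is
`ν (Ω⁻¹ - X₀⁻¹)` (`dual_eq_of_stationary`). For any other decomposition `c` solves the coupled power
equation of the whole network, whose matrix `I - D Ψᵀ` is invertible because the forward powers are
feasible (`isUnit_det_one_sub`), so again `q = c` and the dual is the same
(`dual_eq_of_forall_stationary`). Since water-filling passes to the reverse link, the same
argument applies to the reverse network and returns `Σ` (`BMAC.dual_reverse_eq`). The same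
feasibility gives `q ≥ 0` (`q_nonneg`), so the matrices `Ω̂` are positive definite.
-/

/-! ### Water-filling over a single link -/

namespace Matrix

variable {m n ι : Type*} [Fintype m] [Fintype n] [Fintype ι] [DecidableEq m] [DecidableEq n]
  [DecidableEq ι]

theorem mul_cancel_left_of_mul_eq_one {m ι k R : Type*} [Fintype m] [Fintype ι] [DecidableEq ι]
    [Semiring R] {P : Matrix ι m R}
    {Q : Matrix m ι R} (h : P * Q = 1) (Z : Matrix ι k R) : P * (Q * Z) = Z := by
  rw [← Matrix.mul_assoc, h, Matrix.one_mul]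

theorem diagonal_mul_diagonal_mul {k R : Type*} [Semiring R] (a b : ι → R) (Z : Matrix ι k R) :
    diagonal a * (diagonal b * Z) = diagonal (fun i => a i * b i) * Z := by
  rw [← Matrix.mul_assoc, diagonal_mul_diagonal]

theorem smul_diagonal_mul_eq {k R : Type*} [Semiring R] (c : R) (a : ι → R) (Z : Matrix ι k R) :
    c • (diagonal a * Z) = diagonal (fun i => c * a i) * Z := by
  rw [← Matrix.smul_mul, ← diagonal_smul]
  rfl

theorem inv_conj_one_add_diagonal {A : Matrix m m ℂ} {F : Matrix m ι ℂ}
    (hF : F.conjTranspose * F = 1) {e : ι → ℝ} (he : ∀ i, 0 ≤ e i) :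
    (A * (1 + F * diagonal (fun i => (e i : ℂ)) * F.conjTranspose) * A)⁻¹
      = A⁻¹ * (1 - F * diagonal (fun i => ((e i / (1 + e i) : ℝ) : ℂ)) * F.conjTranspose)
        * A⁻¹ := by
  rw [Matrix.mul_inv_rev, Matrix.mul_inv_rev, ← Matrix.mul_assoc]
  congr 2
  apply Matrix.inv_eq_right_inv
  have key : ∀ i, (e i : ℂ) * ((e i / (1 + e i) : ℝ) : ℂ)
      = (e i : ℂ) - ((e i / (1 + e i) : ℝ) : ℂ) := by
    intro i
    have := he i
    have h1 : (1 + e i) ≠ 0 := by positivity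
    norm_cast
    field_simp
    ring
  simp only [Matrix.add_mul, Matrix.mul_sub, Matrix.one_mul, Matrix.mul_one, Matrix.mul_assoc,
    mul_cancel_left_of_mul_eq_one hF, diagonal_mul_diagonal_mul, key]
  rw [← diagonal_sub]
  simp only [Matrix.sub_mul, Matrix.mul_sub]
  abel

/-- The power `(ν - δ⁻²)⁺` that water-filling at level `ν` puts on an eigenchannel of gain `δ`. -/
noncomputable def waterPower (ν δ : ℝ) : ℝ := max (ν - (δ ^ 2)⁻¹) 0

theorem waterPower_nonneg (ν δ : ℝ) : 0 ≤ waterPower ν δ := le_max_right _ _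

/-- On an active eigenchannel `1 + δ² (ν - δ⁻²)⁺ = δ² ν`. -/
theorem mul_waterPower_div (ν : ℝ) {δ : ℝ} (hδ : 0 < δ) :
    ν * (δ ^ 2 * waterPower ν δ / (1 + δ ^ 2 * waterPower ν δ)) = waterPower ν δ := by
  rw [waterPower]
  rcases le_total (ν - (δ ^ 2)⁻¹) 0 with h | h
  · simp [max_eq_right h]
  · have h2 : 0 < δ ^ 2 := by positivity
    have hν : 0 < ν := by have := inv_pos.mpr h2; linarith
    have : 1 + δ ^ 2 * (ν - (δ ^ 2)⁻¹) = δ ^ 2 * ν := by field_simp; ring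
    rw [max_eq_left h, this]
    field_simp

/-- `S` is the water-filling covariance at level `ν` over the channel `A⁻¹ H C⁻¹`, whose thin
singular value decomposition is `F diag(δ) G†`. The weights `A` and `C` stand for the square roots
of the noise covariances of the link and of its reverse link. -/
structure IsWaterFilling (A : Matrix m m ℂ) (C : Matrix n n ℂ) (H : Matrix m n ℂ)
    (F : Matrix m ι ℂ) (G : Matrix n ι ℂ) (δ : ι → ℝ) (ν : ℝ) (S : Matrix n n ℂ) : Prop where
  isHermitian_left : A.IsHermitian
  isHermitian_right : C.IsHermitian
  isUnit_left : IsUnit A.det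
  isUnit_right : IsUnit C.det
  left_orthonormal : F.conjTranspose * F = 1
  right_orthonormal : G.conjTranspose * G = 1
  pos : ∀ i, 0 < δ i
  svd : A⁻¹ * H * C⁻¹ = F * diagonal (fun i => (δ i : ℂ)) * G.conjTranspose
  cov : C * S * C = G * diagonal (fun i => (waterPower ν (δ i) : ℂ)) * G.conjTranspose

namespace IsWaterFilling

variable {A : Matrix m m ℂ} {C : Matrix n n ℂ} {H : Matrix m n ℂ} {F : Matrix m ι ℂ}
  {G : Matrix n ι ℂ} {δ : ι → ℝ} {ν : ℝ} {S : Matrix n n ℂ}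

theorem channel_eq (h : IsWaterFilling A C H F G δ ν S) :
    H = A * (F * (diagonal (fun i => (δ i : ℂ)) * (G.conjTranspose * C))) := by
  have := congrArg (fun X => A * X * C) h.svd
  simpa only [Matrix.mul_assoc, Matrix.nonsing_inv_mul _ h.isUnit_right, Matrix.mul_one,
    Matrix.mul_nonsing_inv_cancel_left _ _ h.isUnit_left] using this

theorem conjTranspose_channel_eq (h : IsWaterFilling A C H F G δ ν S) :
    H.conjTranspose = C * (G * (diagonal (fun i => (δ i : ℂ)) * (F.conjTranspose * A))) := by
  have hd : star (fun i => (δ i : ℂ)) = fun i => (δ i : ℂ) := by ext i; simp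
  conv_lhs => rw [h.channel_eq]
  simp only [conjTranspose_mul, diagonal_conjTranspose, conjTranspose_conjTranspose,
    Matrix.mul_assoc, h.isHermitian_left.eq, h.isHermitian_right.eq, hd]

theorem cov_eq (h : IsWaterFilling A C H F G δ ν S) :
    S = C⁻¹ * (G * (diagonal (fun i => (waterPower ν (δ i) : ℂ)) * (G.conjTranspose * C⁻¹))) := by
  have := congrArg (fun X => C⁻¹ * X * C⁻¹) h.cov
  simpa only [Matrix.mul_assoc, Matrix.mul_nonsing_inv _ h.isUnit_right, Matrix.mul_one,
    Matrix.nonsing_inv_mul_cancel_left _ _ h.isUnit_right] using this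

theorem received_inv (h : IsWaterFilling A C H F G δ ν S) :
    (H * S * H.conjTranspose + A * A)⁻¹
      = A⁻¹ * (1 - F * diagonal (fun i => ((δ i ^ 2 * waterPower ν (δ i)
          / (1 + δ i ^ 2 * waterPower ν (δ i)) : ℝ) : ℂ)) * F.conjTranspose) * A⁻¹ := by
  rw [← inv_conj_one_add_diagonal h.left_orthonormal
    (fun i => mul_nonneg (sq_nonneg (δ i)) (waterPower_nonneg ν (δ i)))]
  congr 1
  rw [h.conjTranspose_channel_eq]
  conv_lhs => rw [h.channel_eq, h.cov_eq]
  simp only [Matrix.mul_assoc, Matrix.mul_nonsing_inv_cancel_left _ _ h.isUnit_right,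
    Matrix.nonsing_inv_mul_cancel_left _ _ h.isUnit_right,
    mul_cancel_left_of_mul_eq_one h.right_orthonormal, diagonal_mul_diagonal_mul,
    Matrix.add_mul, Matrix.mul_add, Matrix.one_mul]
  rw [add_comm]
  congr 6
  ext i
  push_cast
  ring

/-- The water-filling covariance of the reverse link at the same level, expressed through the
covariances of the forward link. -/
theorem dual_eq (h : IsWaterFilling A C H F G δ ν S) :
    (ν : ℂ) • ((A * A)⁻¹ - (H * S * H.conjTranspose + A * A)⁻¹)
      = A⁻¹ * (F * (diagonal (fun i => (waterPower ν (δ i) : ℂ)) * (F.conjTranspose * A⁻¹))) := by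
  rw [h.received_inv, Matrix.mul_inv_rev]
  simp only [Matrix.mul_sub, Matrix.sub_mul, Matrix.mul_one, sub_sub_cancel]
  simp only [Matrix.mul_assoc]
  rw [← Matrix.mul_smul, ← Matrix.mul_smul, smul_diagonal_mul_eq]
  congr 4
  ext i
  exact_mod_cast mul_waterPower_div ν (h.pos i)

/-- Water-filling is inherited by the reverse link, with the two sides of the singular value
decomposition exchanged. -/
theorem reverse (h : IsWaterFilling A C H F G δ ν S) :
    IsWaterFilling C A H.conjTranspose G F δ ν
      ((ν : ℂ) • ((A * A)⁻¹ - (H * S * H.conjTranspose + A * A)⁻¹)) where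
  isHermitian_left := h.isHermitian_right
  isHermitian_right := h.isHermitian_left
  isUnit_left := h.isUnit_right
  isUnit_right := h.isUnit_left
  left_orthonormal := h.right_orthonormal
  right_orthonormal := h.left_orthonormal
  pos := h.pos
  svd := by
    rw [h.conjTranspose_channel_eq]
    simp only [Matrix.mul_assoc, Matrix.nonsing_inv_mul_cancel_left _ _ h.isUnit_right,
      Matrix.mul_nonsing_inv _ h.isUnit_left, Matrix.mul_one]
  cov := by
    rw [h.dual_eq]
    simp only [Matrix.mul_assoc, Matrix.mul_nonsing_inv_cancel_left _ _ h.isUnit_left,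
      Matrix.nonsing_inv_mul _ h.isUnit_left, Matrix.mul_one]

theorem cov_eq_reverse_dual (h : IsWaterFilling A C H F G δ ν S) {T : Matrix m m ℂ}
    (hT : T = (ν : ℂ) • ((A * A)⁻¹ - (H * S * H.conjTranspose + A * A)⁻¹)) :
    S = (ν : ℂ) • ((C * C)⁻¹ - (H.conjTranspose * T * H + C * C)⁻¹) := by
  have := h.reverse.dual_eq
  rw [conjTranspose_conjTranspose, ← hT] at this
  rw [this]
  exact h.cov_eq

/-- The stationarity condition: on the range of a water-filling covariance, the weight of the
reverse link agrees with `ν H† (H S H† + A²)⁻¹ H`. -/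
theorem stationary (h : IsWaterFilling A C H F G δ ν S) :
    C * C * S
      = (ν : ℂ) • (H.conjTranspose * (H * S * H.conjTranspose + A * A)⁻¹ * H) * S := by
  rw [h.received_inv, h.conjTranspose_channel_eq]
  conv_rhs => rw [h.channel_eq]
  rw [h.cov_eq]
  simp only [Matrix.mul_assoc, Matrix.mul_nonsing_inv_cancel_left _ _ h.isUnit_right,
    Matrix.nonsing_inv_mul_cancel_left _ _ h.isUnit_left,
    Matrix.mul_nonsing_inv_cancel_left _ _ h.isUnit_left,
    mul_cancel_left_of_mul_eq_one h.right_orthonormal, diagonal_mul_diagonal_mul,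
    mul_cancel_left_of_mul_eq_one h.left_orthonormal, Matrix.smul_mul,
    Matrix.sub_mul, Matrix.mul_sub, Matrix.one_mul]
  simp only [← Matrix.sub_mul, ← Matrix.mul_sub, diagonal_sub]
  rw [← Matrix.mul_smul, ← Matrix.mul_smul, smul_diagonal_mul_eq]
  congr 4
  ext i
  norm_cast
  have h1 := mul_waterPower_div ν (h.pos i)
  have h0 : 0 < 1 + δ i ^ 2 * waterPower ν (δ i) := by
    have := waterPower_nonneg ν (δ i)
    positivity
  refine h1.symm.trans ?_
  field_simp
  ring

/-- If `T` is the dual of a water-filling covariance `S`, both sides are conjugates of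
`G diag(δ² (ν - δ⁻²)⁺) G†`. -/
theorem inv_mul_dual_comm (h : IsWaterFilling A C H F G δ ν S) {T : Matrix m m ℂ}
    (hT : T = (ν : ℂ) • ((A * A)⁻¹ - (H * S * H.conjTranspose + A * A)⁻¹)) :
    (C * C)⁻¹ * H.conjTranspose * T * H = S * H.conjTranspose * (A * A)⁻¹ * H := by
  rw [hT, h.dual_eq, h.conjTranspose_channel_eq, Matrix.mul_inv_rev, Matrix.mul_inv_rev]
  rw [h.channel_eq, h.cov_eq]
  simp only [Matrix.mul_assoc, Matrix.nonsing_inv_mul_cancel_left _ _ h.isUnit_left,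
    Matrix.nonsing_inv_mul_cancel_left _ _ h.isUnit_right,
    Matrix.mul_nonsing_inv_cancel_left _ _ h.isUnit_left,
    mul_cancel_left_of_mul_eq_one h.right_orthonormal, diagonal_mul_diagonal_mul,
    mul_cancel_left_of_mul_eq_one h.left_orthonormal]
  simp only [mul_comm]

end IsWaterFilling
end Matrix

/-! ### Quadratic forms and rank-one updates -/

namespace Matrix

open scoped ComplexOrder

variable {m n : Type*} [Fintype m] [Fintype n]

theorem norm_star_dotProduct_mulVec_conjTranspose (K : Matrix m n ℂ) (v : n → ℂ) (w : m → ℂ) :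
    ‖star v ⬝ᵥ K.conjTranspose *ᵥ w‖ = ‖star w ⬝ᵥ K *ᵥ v‖ := by
  rw [← norm_star, star_dotProduct, star_star, star_mulVec, conjTranspose_conjTranspose,
    ← dotProduct_mulVec]

theorem star_dotProduct_conj_vecMulVec_mulVec (K : Matrix m n ℂ) (v : n → ℂ) (w : m → ℂ) :
    star v ⬝ᵥ (K.conjTranspose * vecMulVec w (star w) * K) *ᵥ v
      = ((‖star w ⬝ᵥ K *ᵥ v‖ ^ 2 : ℝ) : ℂ) := by
  rw [← mulVec_mulVec, ← mulVec_mulVec, vecMulVec_mulVec, dotProduct_mulVec, ← star_mulVec,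
    op_smul_eq_smul, dotProduct_smul, smul_eq_mul, star_dotProduct w, norm_star]
  push_cast
  exact Complex.conj_mul' _

theorem mul_vecMulVec_star_mul_conjTranspose {m : Type*} (K : Matrix m n ℂ) (v : n → ℂ) :
    K * vecMulVec v (star v) * K.conjTranspose = vecMulVec (K *ᵥ v) (star (K *ᵥ v)) := by
  rw [mul_vecMulVec, vecMulVec_mul, star_mulVec]

theorem posSemidef_ofReal_smul_vecMulVec {c : ℝ} (hc : 0 ≤ c) (v : n → ℂ) :
    ((c : ℂ) • vecMulVec v (star v)).PosSemidef :=
  (posSemidef_vecMulVec_self_star v).smul (by exact_mod_cast hc)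

theorem dotProduct_star_self_eq_norm_sq (v : n → ℂ) :
    star v ⬝ᵥ v = ((‖WithLp.toLp 2 v‖ ^ 2 : ℝ) : ℂ) := by
  rw [EuclideanSpace.norm_sq_eq]
  push_cast
  exact Finset.sum_congr rfl fun i _ => by rw [mul_comm]; exact Complex.mul_conj' _

/-- The Sherman-Morrison formula for a Hermitian rank-one update. -/
theorem inv_add_smul_vecMulVec [DecidableEq n] {X : Matrix n n ℂ} (hX : X.PosDef) {p : ℝ}
    (v : n → ℂ) {s : ℝ} (hs : (s : ℂ) = star v ⬝ᵥ X⁻¹ *ᵥ v) (hps : 1 + p * s ≠ 0) :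
    (X + (p : ℂ) • vecMulVec v (star v))⁻¹
      = X⁻¹ - ((p / (1 + p * s) : ℝ) : ℂ) • vecMulVec (X⁻¹ *ᵥ v) (star (X⁻¹ *ᵥ v)) := by
  have u : IsUnit X.det := (isUnit_iff_isUnit_det X).mp hX.isUnit
  apply inv_eq_right_inv
  have h1 : X * vecMulVec (X⁻¹ *ᵥ v) (star (X⁻¹ *ᵥ v)) = vecMulVec v (star (X⁻¹ *ᵥ v)) := by
    rw [mul_vecMulVec, mulVec_mulVec, mul_nonsing_inv _ u, one_mulVec]
  have h2 : vecMulVec v (star v) * X⁻¹ = vecMulVec v (star (X⁻¹ *ᵥ v)) := by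
    rw [vecMulVec_mul, star_mulVec, hX.isHermitian.inv.eq]
  have h3 : vecMulVec v (star v) * vecMulVec (X⁻¹ *ᵥ v) (star (X⁻¹ *ᵥ v))
      = (s : ℂ) • vecMulVec v (star (X⁻¹ *ᵥ v)) := by
    rw [vecMulVec_mul_vecMulVec, ← hs, vecMulVec_smul]
  rw [add_mul, mul_sub, mul_sub, mul_nonsing_inv _ u, mul_smul_comm, h1, smul_mul_assoc, h2,
    smul_mul_assoc, mul_smul_comm, h3]
  have h4 : (p : ℂ) - ((p / (1 + p * s) : ℝ) : ℂ) * (1 + p * s) = 0 := by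
    norm_cast
    field_simp
    ring
  -- The total coefficient of `v (X⁻¹ v)†`, which vanishes by `h4`, is added to the right-hand side
  -- so that the rest is linear.
  have h5 : (1 : Matrix n n ℂ) = 1 + ((p : ℂ) - ((p / (1 + p * s) : ℝ) : ℂ) * (1 + p * s)) •
      vecMulVec v (star (X⁻¹ *ᵥ v)) := by rw [h4, zero_smul, add_zero]
  conv_rhs => rw [h5]
  module

end Matrix

/-! ### Weighted comparison for the power equation -/

/-- A nonnegative vector with `x ≤ D Ψᵀ x` vanishes when the powers `p` are feasible, that is
`D (1 + Ψ p) ≤ p`: pairing the inequality with `1 + Ψ p` leaves `∑ x ≤ 0`. -/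
theorem eq_zero_of_le_diag_mul_transpose {α : Type*} [Fintype α] {D p : α → ℝ}
    {Ψ : Matrix α α ℝ} (hΨ : ∀ a b, 0 ≤ Ψ a b) (hp : ∀ a, 0 ≤ p a)
    (hD : ∀ a, D a * (1 + ∑ b, p b * Ψ a b) ≤ p a) {x : α → ℝ} (hx : ∀ a, 0 ≤ x a)
    (hle : ∀ a, x a ≤ D a * ∑ b, Ψ b a * x b) : x = 0 := by
  have hu : ∀ a, 0 ≤ 1 + ∑ b, p b * Ψ a b := fun a =>
    add_nonneg zero_le_one (Finset.sum_nonneg fun b _ => mul_nonneg (hp b) (hΨ a b))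
  have hz : ∀ a, 0 ≤ ∑ b, Ψ b a * x b := fun a =>
    Finset.sum_nonneg fun b _ => mul_nonneg (hΨ b a) (hx b)
  have h1 : ∀ a, x a * (1 + ∑ b, p b * Ψ a b) ≤ p a * ∑ b, Ψ b a * x b := fun a => by
    nlinarith [mul_le_mul_of_nonneg_right (hle a) (hu a), mul_le_mul_of_nonneg_right (hD a) (hz a)]
  have h2 := Finset.sum_le_sum fun a (_ : a ∈ Finset.univ) => h1 a
  have h3 : ∑ a, p a * ∑ b, Ψ b a * x b = ∑ a, x a * ∑ b, p b * Ψ a b := by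
    simp only [Finset.mul_sum]
    rw [Finset.sum_comm]
    exact Finset.sum_congr rfl fun a _ => Finset.sum_congr rfl fun b _ => by ring
  simp only [mul_add, mul_one, Finset.sum_add_distrib] at h2
  have h4 : ∑ a, x a = 0 := le_antisymm (by linarith) (Finset.sum_nonneg fun a _ => hx a)
  funext a
  exact (Finset.sum_eq_zero_iff_of_nonneg fun a _ => hx a).mp h4 a (Finset.mem_univ a)

/-! ### Interference of streams as quadratic forms -/

namespace BMAC

open Matrix
open scoped ComplexOrder

variable {L : ℕ} {N : BMAC L} {S : N.TxFamily}

theorem coupling_nonneg (N : BMAC L) (l k : Fin L) : 0 ≤ N.Φ l k := by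
  rcases N.coupling_zero_or_one l k with h | h <;> simp [h]

theorem omega_posDef (hS : ∀ l, (S l).PosSemidef) (l : Fin L) : (N.omega S l).PosDef := by
  refine PosDef.one.add_posSemidef (posSemidef_sum _ fun k _ => ?_)
  exact ((hS k).mul_mul_conjTranspose_same (N.H l k)).smul
    (by exact_mod_cast N.coupling_nonneg l k)

theorem omegaHat_posDef {Shat : N.RxFamily} (hS : ∀ l, (Shat l).PosSemidef) (l : Fin L) :
    (N.omegaHat Shat l).PosDef := by
  rw [omegaHat_eq_omega_reverse]
  exact omega_posDef (N := N.reverse) hS l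

namespace Decomposition

variable (d : Decomposition N S)

include d in
theorem posSemidef (l : Fin L) : (S l).PosSemidef := by
  rw [d.sum_eq l]
  exact posSemidef_sum _ fun m _ => posSemidef_ofReal_smul_vecMulVec (d.p_nonneg l m) _

theorem gain_nonneg (a b : d.Stream) : 0 ≤ d.gain a b := sq_nonneg _

theorem crossTalk_nonneg (a b : d.Stream) : 0 ≤ d.crossTalk a b := by
  unfold crossTalk
  split_ifs
  · exact le_rfl
  · exact d.gain_nonneg a b
  · exact mul_nonneg (N.coupling_nonneg _ _) (d.gain_nonneg a b)

/-- The received signal covariance of link `l` from the streams with index at least `k`, together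
with the interference and noise of the other links. -/
noncomputable def residual (l : Fin L) (k : ℕ) : Matrix (Fin (N.nR l)) (Fin (N.nR l)) ℂ :=
  (∑ i ∈ {i : Fin (d.M l) | k ≤ (i : ℕ)}, (d.p l i : ℂ) •
    (N.H l l * vecMulVec (d.t l i) (star (d.t l i)) * (N.H l l).conjTranspose)) + N.omega S l

theorem mmse_eq (l : Fin L) (m : Fin (d.M l)) :
    d.mmse l m = (d.residual l (m + 1))⁻¹ *ᵥ (N.H l l *ᵥ d.t l m) := by
  rw [mmse, residual]
  congr 4
  ext i
  simp

theorem residual_posDef (l : Fin L) (k : ℕ) : (d.residual l k).PosDef := by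
  refine PosDef.posSemidef_add (posSemidef_sum _ fun i _ => ?_) (omega_posDef d.posSemidef l)
  rw [mul_vecMulVec_star_mul_conjTranspose]
  exact posSemidef_ofReal_smul_vecMulVec (d.p_nonneg l i) _

theorem residual_zero (l : Fin L) :
    d.residual l 0 = N.H l l * S l * (N.H l l).conjTranspose + N.omega S l := by
  conv_rhs => rw [d.sum_eq l]
  simp [residual, Matrix.mul_sum, Matrix.sum_mul]

theorem residual_last (l : Fin L) : d.residual l (d.M l) = N.omega S l := by
  rw [residual, Finset.filter_false_of_mem, Finset.sum_empty, zero_add]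
  intro i _
  exact not_le.mpr i.isLt

theorem residual_eq_succ (l : Fin L) (m : Fin (d.M l)) :
    d.residual l m = d.residual l (m + 1) + (d.p l m : ℂ) •
      vecMulVec (N.H l l *ᵥ d.t l m) (star (N.H l l *ᵥ d.t l m)) := by
  have : (Finset.univ.filter fun i : Fin (d.M l) => (m : ℕ) ≤ i)
      = insert m (Finset.univ.filter fun i : Fin (d.M l) => (m : ℕ) + 1 ≤ i) := by
    ext i
    simp only [Finset.mem_filter, Finset.mem_univ, true_and, Finset.mem_insert, Fin.ext_iff]
    omega
  rw [residual, residual, this, Finset.sum_insert (by simp),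
    mul_vecMulVec_star_mul_conjTranspose]
  abel

/-- Interference at stream `a` splits into the interference of the other links and the part of the
own link that the successive cancellation has not removed. -/
theorem sum_mul_crossTalk (a : d.Stream) (x : d.Stream → ℝ) :
    ∑ b, x b * d.crossTalk a b
      = ∑ i ∈ {i : Fin (d.M a.1) | (a.2 : ℕ) + 1 ≤ (i : ℕ)}, x ⟨a.1, i⟩ * d.gain a ⟨a.1, i⟩
        + ∑ k, N.Φ a.1 k * ∑ n, x ⟨k, n⟩ * d.gain a ⟨k, n⟩ := by
  rw [Fintype.sum_sigma, ← Finset.add_sum_erase _ _ (Finset.mem_univ a.1),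
    ← Finset.add_sum_erase (a := a.1) _ (fun k => N.Φ a.1 k * _) (Finset.mem_univ a.1),
    N.coupling_self, zero_mul, zero_add, Finset.sum_filter]
  congr 1
  · refine Finset.sum_congr rfl fun n _ => ?_
    by_cases h : (n : ℕ) ≤ a.2
    · simp [crossTalk, h, (Fin.le_def.mpr h).not_gt]
    · simp [crossTalk, h, not_le.mp h]
  · refine Finset.sum_congr rfl fun k hk => ?_
    have hk' : ¬ a.1 = k := fun h => (Finset.mem_erase.mp hk).1 h.symm
    rw [Finset.mul_sum]
    refine Finset.sum_congr rfl fun n _ => ?_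
    simp only [crossTalk, if_neg hk']
    ring

theorem sum_crossTalk_mul (a : d.Stream) (x : d.Stream → ℝ) :
    ∑ b, d.crossTalk b a * x b
      = ∑ i ∈ {i : Fin (d.M a.1) | (i : ℕ) < a.2}, x ⟨a.1, i⟩ * d.gain ⟨a.1, i⟩ a
        + ∑ k, N.Φ k a.1 * ∑ n, x ⟨k, n⟩ * d.gain ⟨k, n⟩ a := by
  rw [Fintype.sum_sigma, ← Finset.add_sum_erase _ _ (Finset.mem_univ a.1),
    ← Finset.add_sum_erase (a := a.1) _ (fun k => N.Φ k a.1 * _) (Finset.mem_univ a.1),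
    N.coupling_self, zero_mul, zero_add, Finset.sum_filter]
  congr 1
  · refine Finset.sum_congr rfl fun n _ => ?_
    by_cases h : (a.2 : ℕ) ≤ n
    · simp [crossTalk, h, (Fin.le_def.mpr h).not_gt]
    · simp [crossTalk, h, not_le.mp h, mul_comm]
  · refine Finset.sum_congr rfl fun k hk => ?_
    have hk' : ¬ k = a.1 := (Finset.mem_erase.mp hk).1
    rw [Finset.mul_sum]
    refine Finset.sum_congr rfl fun n _ => ?_
    simp only [crossTalk, if_neg hk']
    ring

theorem star_t_dotProduct_t (l : Fin L) (m : Fin (d.M l)) : star (d.t l m) ⬝ᵥ d.t l m = 1 := by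
  rw [dotProduct_star_self_eq_norm_sq, d.t_unit]
  simp

theorem star_r_dotProduct_r {l : Fin L} {m : Fin (d.M l)} (h : d.mmse l m ≠ 0) :
    star (d.r l m) ⬝ᵥ d.r l m = 1 := by
  have : ‖WithLp.toLp 2 (d.mmse l m)‖ ≠ 0 := by simpa using h
  rw [r, star_smul, smul_dotProduct, dotProduct_smul, dotProduct_star_self_eq_norm_sq]
  simp only [smul_eq_mul, RCLike.star_def, Complex.conj_ofReal]
  norm_cast
  field_simp

/-- Noise plus interference at a receiver with unit receive vector, as a quadratic form. -/
theorem interference_eq {a : d.Stream} (h : d.mmse a.1 a.2 ≠ 0) :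
    ((1 + ∑ b, d.p b.1 b.2 * d.crossTalk a b : ℝ) : ℂ)
      = star (d.r a.1 a.2) ⬝ᵥ d.residual a.1 (a.2 + 1) *ᵥ d.r a.1 a.2 := by
  have key : ∀ k n, star (d.r a.1 a.2) ⬝ᵥ (N.H a.1 k * vecMulVec (d.t k n) (star (d.t k n)) *
      (N.H a.1 k).conjTranspose) *ᵥ d.r a.1 a.2 = (d.gain a ⟨k, n⟩ : ℂ) := by
    intro k n
    have := star_dotProduct_conj_vecMulVec_mulVec (N.H a.1 k).conjTranspose (d.r a.1 a.2) (d.t k n)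
    rw [conjTranspose_conjTranspose, norm_star_dotProduct_mulVec_conjTranspose] at this
    exact this
  rw [d.sum_mul_crossTalk a fun b => d.p b.1 b.2, residual, omega]
  conv_rhs =>
    enter [2, 1, 2, 2, 2, k]
    rw [d.sum_eq k]
  simp only [Matrix.mul_sum, Matrix.sum_mul, add_mulVec, sum_mulVec, smul_mulVec, dotProduct_add,
    dotProduct_sum, dotProduct_smul, one_mulVec, d.star_r_dotProduct_r h, key, Matrix.mul_smul,
    Matrix.smul_mul]
  push_cast
  simp only [smul_eq_mul]
  ring

/-- The reverse covariances `∑_m x_{l,m} r_{l,m} r_{l,m}†` for arbitrary reverse powers `x`. -/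
noncomputable def dualOf (x : d.Stream → ℝ) : N.RxFamily := fun l =>
  ∑ m : Fin (d.M l), (x ⟨l, m⟩ : ℂ) • vecMulVec (d.r l m) (star (d.r l m))

theorem dualOf_q : d.dualOf d.q = d.dual := rfl

/-- Noise plus interference at a receiver of the reverse network, as a quadratic form. -/
theorem reverse_interference_eq (a : d.Stream) (x : d.Stream → ℝ) :
    ((1 + ∑ b, d.crossTalk b a * x b : ℝ) : ℂ)
      = star (d.t a.1 a.2) ⬝ᵥ (N.omegaHat (d.dualOf x) a.1 + (N.H a.1 a.1).conjTranspose *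
          (∑ i ∈ {i : Fin (d.M a.1) | (i : ℕ) < a.2}, (x ⟨a.1, i⟩ : ℂ) • vecMulVec (d.r a.1 i) (star (d.r a.1 i))) *
          N.H a.1 a.1) *ᵥ d.t a.1 a.2 := by
  have key : ∀ k n, star (d.t a.1 a.2) ⬝ᵥ ((N.H k a.1).conjTranspose * vecMulVec (d.r k n)
      (star (d.r k n)) * N.H k a.1) *ᵥ d.t a.1 a.2 = (d.gain ⟨k, n⟩ a : ℂ) := fun k n =>
    star_dotProduct_conj_vecMulVec_mulVec (N.H k a.1) (d.t a.1 a.2) (d.r k n)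
  rw [d.sum_crossTalk_mul, omegaHat]
  simp only [dualOf, Matrix.mul_sum, Matrix.sum_mul, add_mulVec, sum_mulVec, smul_mulVec,
    dotProduct_add, dotProduct_sum, dotProduct_smul, one_mulVec, d.star_t_dotProduct_t, key,
    Matrix.mul_smul, Matrix.smul_mul]
  push_cast
  simp only [smul_eq_mul]
  ring

/-! ### The power equation of the reverse network -/

theorem interference_pos (a : d.Stream) : 0 < 1 + ∑ b, d.p b.1 b.2 * d.crossTalk a b :=
  add_pos_of_pos_of_nonneg one_pos
    (Finset.sum_nonneg fun b _ => mul_nonneg (d.p_nonneg _ _) (d.crossTalk_nonneg a b))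

theorem sinr_div_gain_nonneg (a : d.Stream) : 0 ≤ d.sinr a / d.gain a a :=
  div_nonneg (div_nonneg (mul_nonneg (d.p_nonneg _ _) (d.gain_nonneg a a))
    (d.interference_pos a).le) (d.gain_nonneg a a)

theorem sinr_div_gain_mul_le (a : d.Stream) :
    d.sinr a / d.gain a a * (1 + ∑ b, d.p b.1 b.2 * d.crossTalk a b) ≤ d.p a.1 a.2 := by
  have h := (d.interference_pos a).ne'
  -- Equality holds unless the gain vanishes, where the quotient is `0`.
  by_cases hg : d.gain a a = 0
  · simp [hg, d.p_nonneg]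
  · refine le_of_eq ?_
    rw [sinr]
    field_simp

/-- The power equation `q = D (1 + Ψᵀ q)` in matrix form. -/
theorem sub_mulVec_eq_iff (x : d.Stream → ℝ) :
    (1 - d.diagD * d.crossTalk.transpose) *ᵥ x = d.diagD *ᵥ 1 ↔
      ∀ a, x a = d.sinr a / d.gain a a * (1 + ∑ b, d.crossTalk b a * x b) := by
  rw [sub_mulVec, one_mulVec, sub_eq_iff_eq_add, ← mulVec_mulVec, ← mulVec_add, funext_iff]
  refine forall_congr' fun a => ?_
  rw [diagD, mulVec_diagonal]
  simp [mulVec, dotProduct]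

/-- Feasibility of the forward powers makes the reverse power equation uniquely solvable: the
absolute values of a kernel vector satisfy the comparison inequality. -/
theorem isUnit_det_one_sub : IsUnit (1 - d.diagD * d.crossTalk.transpose).det := by
  rw [isUnit_iff_ne_zero]
  intro h0
  obtain ⟨x, hx, h⟩ := exists_mulVec_eq_zero_iff.mpr h0
  rw [sub_mulVec, one_mulVec, sub_eq_zero, ← mulVec_mulVec] at h
  have hle : ∀ a, |x a| ≤ d.sinr a / d.gain a a * ∑ b, d.crossTalk b a * |x b| := by
    intro a
    have ha := congrFun h a
    rw [diagD, mulVec_diagonal] at ha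
    rw [ha, abs_mul, abs_of_nonneg (d.sinr_div_gain_nonneg a)]
    refine mul_le_mul_of_nonneg_left ?_ (d.sinr_div_gain_nonneg a)
    refine (Finset.abs_sum_le_sum_abs _ _).trans (Finset.sum_le_sum fun b _ => ?_)
    change |d.crossTalk b a * x b| ≤ _
    rw [abs_mul, abs_of_nonneg (d.crossTalk_nonneg b a)]
  have := eq_zero_of_le_diag_mul_transpose d.crossTalk_nonneg
    (p := fun a => d.p a.1 a.2) (fun a => d.p_nonneg _ _) d.sinr_div_gain_mul_le
    (fun a => abs_nonneg (x a)) hle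
  exact hx (funext fun a => abs_eq_zero.mp (congrFun this a))

theorem q_eq (a : d.Stream) :
    d.q a = d.sinr a / d.gain a a * (1 + ∑ b, d.crossTalk b a * d.q b) := by
  refine (d.sub_mulVec_eq_iff d.q).mp ?_ a
  rw [q, mulVec_mulVec, mul_nonsing_inv _ d.isUnit_det_one_sub, one_mulVec]

theorem eq_q_of_power_eq {x : d.Stream → ℝ}
    (hx : ∀ a, x a = d.sinr a / d.gain a a * (1 + ∑ b, d.crossTalk b a * x b)) : x = d.q := by
  rw [q, ← (d.sub_mulVec_eq_iff x).mpr hx, mulVec_mulVec, nonsing_inv_mul _ d.isUnit_det_one_sub,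
    one_mulVec]

theorem q_nonneg (a : d.Stream) : 0 ≤ d.q a := by
  -- The negative part of `q` satisfies the comparison inequality, hence vanishes.
  have hle : ∀ a, (d.q a)⁻ ≤ d.sinr a / d.gain a a * ∑ b, d.crossTalk b a * (d.q b)⁻ := by
    intro a
    have h0 : 0 ≤ ∑ b, d.crossTalk b a * (d.q b)⁻ :=
      Finset.sum_nonneg fun b _ => mul_nonneg (d.crossTalk_nonneg b a) (negPart_nonneg _)
    have hD := d.sinr_div_gain_nonneg a
    refine (negPart_def _).trans_le (sup_le ?_ (mul_nonneg hD h0))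
    rw [d.q_eq a, ← mul_neg]
    refine mul_le_mul_of_nonneg_left ?_ hD
    have : -∑ b, d.crossTalk b a * d.q b ≤ ∑ b, d.crossTalk b a * (d.q b)⁻ := by
      rw [← Finset.sum_neg_distrib]
      refine Finset.sum_le_sum fun b _ => ?_
      rw [← mul_neg]
      exact mul_le_mul_of_nonneg_left (neg_le_negPart _) (d.crossTalk_nonneg b a)
    linarith
  have := eq_zero_of_le_diag_mul_transpose d.crossTalk_nonneg
    (p := fun a => d.p a.1 a.2) (fun a => d.p_nonneg _ _) d.sinr_div_gain_mul_le
    (fun a => negPart_nonneg (d.q a)) hle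
  exact negPart_eq_zero.mp (congrFun this a)

theorem dual_posSemidef (l : Fin L) : (d.dual l).PosSemidef :=
  posSemidef_sum _ fun m _ => posSemidef_ofReal_smul_vecMulVec (d.q_nonneg ⟨l, m⟩) _

/-! ### Explicit reverse powers -/

/-- The output `h† X⁻¹ h` of the unnormalized MMSE-SIC filter for a unit-power stream. -/
noncomputable def mmseGain (l : Fin L) (m : Fin (d.M l)) : ℝ :=
  (star (N.H l l *ᵥ d.t l m) ⬝ᵥ d.mmse l m).re

theorem ofReal_mmseGain (l : Fin L) (m : Fin (d.M l)) :
    (d.mmseGain l m : ℂ) = star (N.H l l *ᵥ d.t l m) ⬝ᵥ d.mmse l m := by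
  rw [mmseGain, mmse_eq]
  exact (Complex.eq_re_of_ofReal_le (r := 0)
    (by
      rw [Complex.ofReal_zero]
      exact (d.residual_posDef l (m + 1)).inv.posSemidef.dotProduct_mulVec_nonneg _)).symm

theorem mmseGain_nonneg (l : Fin L) (m : Fin (d.M l)) : 0 ≤ d.mmseGain l m := by
  have := (d.residual_posDef l (m + 1)).inv.posSemidef.dotProduct_mulVec_nonneg
    (N.H l l *ᵥ d.t l m)
  rw [← mmse_eq, ← ofReal_mmseGain] at this
  exact_mod_cast this

theorem mmseGain_pos {l : Fin L} {m : Fin (d.M l)} (h : N.H l l *ᵥ d.t l m ≠ 0) :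
    0 < d.mmseGain l m := by
  have := (d.residual_posDef l (m + 1)).inv.dotProduct_mulVec_pos h
  rw [← mmse_eq, ← ofReal_mmseGain] at this
  exact_mod_cast this

theorem one_add_mul_mmseGain_pos (l : Fin L) (m : Fin (d.M l)) :
    0 < 1 + d.p l m * d.mmseGain l m :=
  add_pos_of_pos_of_nonneg one_pos (mul_nonneg (d.p_nonneg l m) (d.mmseGain_nonneg l m))

theorem inv_residual (l : Fin L) (m : Fin (d.M l)) :
    (d.residual l m)⁻¹ = (d.residual l (m + 1))⁻¹
      - ((d.p l m / (1 + d.p l m * d.mmseGain l m) : ℝ) : ℂ) •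
        vecMulVec (d.mmse l m) (star (d.mmse l m)) := by
  rw [d.residual_eq_succ l m, inv_add_smul_vecMulVec (d.residual_posDef l (m + 1)) _
    (s := d.mmseGain l m) (by rw [ofReal_mmseGain, mmse_eq])
    (d.one_add_mul_mmseGain_pos l m).ne', ← mmse_eq]

theorem norm_sq_smul_vecMulVec_r (l : Fin L) (m : Fin (d.M l)) :
    ((‖WithLp.toLp 2 (d.mmse l m)‖ ^ 2 : ℝ) : ℂ) • vecMulVec (d.r l m) (star (d.r l m))
      = vecMulVec (d.mmse l m) (star (d.mmse l m)) := by
  by_cases h : d.mmse l m = 0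
  · simp [h]
  · have : ‖WithLp.toLp 2 (d.mmse l m)‖ ≠ 0 := by simpa using h
    rw [r, star_smul, smul_vecMulVec, vecMulVec_smul, smul_smul, smul_smul]
    simp only [RCLike.star_def, Complex.conj_ofReal]
    norm_cast
    field_simp
    simp

/-- The reverse powers that turn `∑_m q_{l,m} r_{l,m} r_{l,m}†` into
`ν (Ω_l⁻¹ - (H_{l,l} Σ_l H_{l,l}† + Ω_l)⁻¹)`, by telescoping rank-one updates. -/
noncomputable def levelPower (ν : ℝ) (l : Fin L) (m : Fin (d.M l)) : ℝ :=
  ν * (d.p l m * ‖WithLp.toLp 2 (d.mmse l m)‖ ^ 2 / (1 + d.p l m * d.mmseGain l m))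

theorem levelPower_smul_vecMulVec (ν : ℝ) (l : Fin L) (m : Fin (d.M l)) :
    (d.levelPower ν l m : ℂ) • vecMulVec (d.r l m) (star (d.r l m))
      = (ν : ℂ) • ((d.residual l (m + 1))⁻¹ - (d.residual l m)⁻¹) := by
  rw [d.inv_residual l m, sub_sub_cancel, ← norm_sq_smul_vecMulVec_r, smul_smul, smul_smul,
    levelPower]
  congr 1
  push_cast
  ring

theorem sum_levelPower_lt (ν : ℝ) (l : Fin L) {k : ℕ} (hk : k ≤ d.M l) :
    ∑ i ∈ {i : Fin (d.M l) | (i : ℕ) < k},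
        (d.levelPower ν l i : ℂ) • vecMulVec (d.r l i) (star (d.r l i))
      = (ν : ℂ) • ((d.residual l k)⁻¹ - (d.residual l 0)⁻¹) := by
  induction k with
  | zero => simp
  | succ k ih =>
    have : (Finset.univ.filter fun i : Fin (d.M l) => (i : ℕ) < k + 1)
        = insert ⟨k, hk⟩ (Finset.univ.filter fun i : Fin (d.M l) => (i : ℕ) < k) := by
      ext i
      simp only [Finset.mem_filter, Finset.mem_univ, true_and, Finset.mem_insert, Fin.ext_iff]
      omega
    rw [this, Finset.sum_insert (by simp), ih (Nat.le_of_succ_le hk), levelPower_smul_vecMulVec]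
    module

theorem sum_levelPower (ν : ℝ) (l : Fin L) :
    ∑ i, (d.levelPower ν l i : ℂ) • vecMulVec (d.r l i) (star (d.r l i))
      = (ν : ℂ) • ((N.omega S l)⁻¹
          - (N.H l l * S l * (N.H l l).conjTranspose + N.omega S l)⁻¹) := by
  rw [← residual_zero d, ← residual_last d, ← sum_levelPower_lt d ν l le_rfl,
    Finset.filter_true_of_mem fun i _ => i.isLt]

theorem star_r_dotProduct (l : Fin L) (m : Fin (d.M l)) :
    star (d.r l m) ⬝ᵥ N.H l l *ᵥ d.t l m
      = ((d.mmseGain l m / ‖WithLp.toLp 2 (d.mmse l m)‖ : ℝ) : ℂ) := by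
  have h : star (d.mmse l m) ⬝ᵥ N.H l l *ᵥ d.t l m = (d.mmseGain l m : ℂ) := by
    rw [star_dotProduct, ← ofReal_mmseGain]
    simp
  rw [r, star_smul, smul_dotProduct, h]
  simp [div_eq_inv_mul]

theorem gain_self (a : d.Stream) :
    d.gain a a = (d.mmseGain a.1 a.2 / ‖WithLp.toLp 2 (d.mmse a.1 a.2)‖) ^ 2 := by
  rw [gain, star_r_dotProduct, Complex.norm_real, Real.norm_eq_abs, sq_abs]

/-- The entries of `D`. If the filter vanishes, both sides are `0`: the left one through division by
a zero gain, the right one through the factor `‖mmse‖`. -/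
theorem sinr_div_gain_eq (a : d.Stream) :
    d.sinr a / d.gain a a
      = d.p a.1 a.2 * ‖WithLp.toLp 2 (d.mmse a.1 a.2)‖ ^ 2 / d.mmseGain a.1 a.2 := by
  by_cases h : d.mmse a.1 a.2 = 0
  · simp [gain_self, h]
  have hn : ‖WithLp.toLp 2 (d.mmse a.1 a.2)‖ ≠ 0 := by simpa using h
  have h0 : N.H a.1 a.1 *ᵥ d.t a.1 a.2 ≠ 0 := fun h0 => h (by rw [mmse_eq, h0, mulVec_zero])
  have hs := (d.mmseGain_pos h0).ne'
  have hu : 1 + ∑ b, d.p b.1 b.2 * d.crossTalk a b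
      = d.mmseGain a.1 a.2 / ‖WithLp.toLp 2 (d.mmse a.1 a.2)‖ ^ 2 := by
    have hX : d.residual a.1 (a.2 + 1) *ᵥ d.mmse a.1 a.2 = N.H a.1 a.1 *ᵥ d.t a.1 a.2 := by
      rw [mmse_eq, mulVec_mulVec, mul_nonsing_inv, one_mulVec]
      exact (isUnit_iff_isUnit_det _).mp (d.residual_posDef _ _).isUnit
    have := d.interference_eq h
    conv_rhs at this => rw [r, mulVec_smul, hX, ← r, dotProduct_smul, star_r_dotProduct]
    rw [smul_eq_mul, ← Complex.ofReal_mul, Complex.ofReal_inj] at this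
    rw [this]
    field_simp
  rw [sinr, hu, gain_self]
  field_simp

/-- The stationarity condition on the range of `Σ_l` holds at each stream of positive power. -/
theorem stationary_at_stream {l : Fin L} {Q : Matrix (Fin (N.nT l)) (Fin (N.nT l)) ℂ}
    (hQ : Q * S l = 0) {m : Fin (d.M l)} (hp : 0 < d.p l m) :
    star (d.t l m) ⬝ᵥ Q *ᵥ d.t l m = 0 := by
  have h : star (d.t l m) ⬝ᵥ (Q * S l * Q.conjTranspose) *ᵥ d.t l m = 0 := by
    rw [hQ, Matrix.zero_mul, zero_mulVec, dotProduct_zero]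
  have key : ∀ i, star (d.t l m) ⬝ᵥ (Q * vecMulVec (d.t l i) (star (d.t l i)) *
      Q.conjTranspose) *ᵥ d.t l m = ((‖star (d.t l m) ⬝ᵥ Q *ᵥ d.t l i‖ ^ 2 : ℝ) : ℂ) := by
    intro i
    have := star_dotProduct_conj_vecMulVec_mulVec Q.conjTranspose (d.t l m) (d.t l i)
    rw [conjTranspose_conjTranspose, norm_star_dotProduct_mulVec_conjTranspose] at this
    exact this
  rw [d.sum_eq l] at h
  simp only [Matrix.mul_sum, Matrix.sum_mul, sum_mulVec, smul_mulVec, dotProduct_sum,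
    dotProduct_smul, Matrix.mul_smul, Matrix.smul_mul, key, smul_eq_mul] at h
  norm_cast at h
  have h2 := (Finset.sum_eq_zero_iff_of_nonneg fun i _ =>
    mul_nonneg (d.p_nonneg l i) (sq_nonneg _)).mp h m (Finset.mem_univ m)
  simpa [hp.ne'] using h2

/-- Under the stationarity condition the explicit powers solve the power equation of link `l`. -/
theorem levelPower_eq {l : Fin L} {ν : ℝ} {B : Matrix (Fin (N.nT l)) (Fin (N.nT l)) ℂ}
    (hB : B.PosDef)
    (hK : B * S l = (ν : ℂ) • ((N.H l l).conjTranspose *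
      (N.H l l * S l * (N.H l l).conjTranspose + N.omega S l)⁻¹ * N.H l l) * S l)
    (m : Fin (d.M l)) :
    (d.levelPower ν l m : ℂ) = ((d.sinr ⟨l, m⟩ / d.gain ⟨l, m⟩ ⟨l, m⟩ : ℝ) : ℂ) *
      (star (d.t l m) ⬝ᵥ (B + (N.H l l).conjTranspose *
          (∑ i ∈ {i : Fin (d.M l) | (i : ℕ) < m},
            (d.levelPower ν l i : ℂ) • vecMulVec (d.r l i) (star (d.r l i))) *
          N.H l l) *ᵥ d.t l m) := by
  rcases (d.p_nonneg l m).eq_or_lt with hp | hp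
  · simp [levelPower, sinr, ← hp]
  have hquad : ∀ Z : Matrix (Fin (N.nR l)) (Fin (N.nR l)) ℂ,
      star (d.t l m) ⬝ᵥ ((N.H l l).conjTranspose * Z * N.H l l) *ᵥ d.t l m
        = star (N.H l l *ᵥ d.t l m) ⬝ᵥ Z *ᵥ (N.H l l *ᵥ d.t l m) := by
    intro Z
    rw [← mulVec_mulVec, ← mulVec_mulVec, dotProduct_mulVec, star_mulVec]
  have hst : star (d.t l m) ⬝ᵥ B *ᵥ d.t l m = ν * (star (N.H l l *ᵥ d.t l m) ⬝ᵥ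
      (d.residual l 0)⁻¹ *ᵥ (N.H l l *ᵥ d.t l m)) := by
    rw [← d.residual_zero, ← sub_eq_zero, ← Matrix.sub_mul] at hK
    have := d.stationary_at_stream hK hp
    rwa [sub_mulVec, dotProduct_sub, sub_eq_zero, smul_mulVec, dotProduct_smul, hquad] at this
  have ht : d.t l m ≠ 0 := fun h => by simpa [h] using d.t_unit l m
  -- A stream of positive power reaches its receiver: otherwise stationarity gives `t† B t = 0`.
  have h0 : N.H l l *ᵥ d.t l m ≠ 0 := by
    intro h0
    have := hB.dotProduct_mulVec_pos ht
    simp [hst, h0] at this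
  have hs := d.mmseGain_pos h0
  have hps := d.one_add_mul_mmseGain_pos l m
  have hY : star (N.H l l *ᵥ d.t l m) ⬝ᵥ (d.residual l m)⁻¹ *ᵥ (N.H l l *ᵥ d.t l m)
      = ((d.mmseGain l m / (1 + d.p l m * d.mmseGain l m) : ℝ) : ℂ) := by
    have hw : star (d.mmse l m) ⬝ᵥ N.H l l *ᵥ d.t l m = (d.mmseGain l m : ℂ) := by
      rw [star_dotProduct, ← ofReal_mmseGain]
      simp
    rw [inv_residual, sub_mulVec, dotProduct_sub, ← mmse_eq, ← ofReal_mmseGain, smul_mulVec,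
      vecMulVec_mulVec, hw, op_smul_eq_smul, dotProduct_smul, dotProduct_smul, ← ofReal_mmseGain]
    simp only [smul_eq_mul]
    norm_cast
    field_simp
    ring
  rw [d.sum_levelPower_lt ν l m.isLt.le, add_mulVec, dotProduct_add, hst, hquad, smul_mulVec,
    sub_mulVec, dotProduct_smul, dotProduct_sub, hY, sinr_div_gain_eq, levelPower, smul_eq_mul,
    ← mul_add, add_sub_cancel]
  norm_cast
  field_simp

/-- For a fixed noise covariance of the reverse link the power equation is triangular in the
streams of the link, so its solution is the explicit one. -/
theorem dual_eq_of_stationary {l : Fin L} {ν : ℝ}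
    (hK : N.omegaHat d.dual l * S l = (ν : ℂ) • ((N.H l l).conjTranspose *
      (N.H l l * S l * (N.H l l).conjTranspose + N.omega S l)⁻¹ * N.H l l) * S l) :
    d.dual l = (ν : ℂ) • ((N.omega S l)⁻¹
      - (N.H l l * S l * (N.H l l).conjTranspose + N.omega S l)⁻¹) := by
  have key : ∀ m, d.q ⟨l, m⟩ = d.levelPower ν l m := by
    intro m
    induction m using WellFoundedLT.induction with
    | ind m ih =>
      apply Complex.ofReal_injective
      rw [d.levelPower_eq (omegaHat_posDef d.dual_posSemidef l) hK m, d.q_eq, Complex.ofReal_mul,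
        d.reverse_interference_eq, dualOf_q]
      have hsum : ∑ i ∈ {i : Fin (d.M l) | (i : ℕ) < m},
            (d.q ⟨l, i⟩ : ℂ) • vecMulVec (d.r l i) (star (d.r l i))
          = ∑ i ∈ {i : Fin (d.M l) | (i : ℕ) < m},
            (d.levelPower ν l i : ℂ) • vecMulVec (d.r l i) (star (d.r l i)) :=
        Finset.sum_congr rfl fun i hi => by rw [ih i (by simpa using hi)]
      rw [hsum]
  rw [← sum_levelPower d, dual]
  exact Finset.sum_congr rfl fun m _ => by rw [key m]

/-- If the stationarity condition holds in all links for a family `Shat` of the explicit form,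
the covariance transformation maps each decomposition to `Shat`. -/
theorem dual_eq_of_forall_stationary {Shat : N.RxFamily} (hpos : ∀ l, (Shat l).PosSemidef)
    {ν : Fin L → ℝ}
    (hShat : ∀ l, Shat l = (ν l : ℂ) • ((N.omega S l)⁻¹
      - (N.H l l * S l * (N.H l l).conjTranspose + N.omega S l)⁻¹))
    (hK : ∀ l, N.omegaHat Shat l * S l = (ν l : ℂ) • ((N.H l l).conjTranspose *
      (N.H l l * S l * (N.H l l).conjTranspose + N.omega S l)⁻¹ * N.H l l) * S l) :
    d.dual = Shat := by
  have hx : d.dualOf (fun a => d.levelPower (ν a.1) a.1 a.2) = Shat := by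
    funext l
    rw [hShat l, ← sum_levelPower d, dualOf]
  have : (fun a : d.Stream => d.levelPower (ν a.1) a.1 a.2) = d.q := by
    refine d.eq_q_of_power_eq fun a => Complex.ofReal_injective ?_
    rw [Complex.ofReal_mul, d.reverse_interference_eq, hx]
    exact d.levelPower_eq (omegaHat_posDef hpos a.1) (hK a.1) a.2
  rw [← dualOf_q, ← this, hx]

end Decomposition

/-! ### The duality theorem -/

theorem IsWaterLevel.exists_isWaterFilling {Shat : N.RxFamily} (hS : ∀ l, (S l).PosSemidef)
    (hShat : ∀ l, (Shat l).PosSemidef) {l : Fin L} {ν : ℝ} (h : N.IsWaterLevel S Shat l ν) :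
    ∃ F G δ, IsWaterFilling (ι := Fin (N.H l l).rank) (CFC.sqrt (N.omega S l))
      (CFC.sqrt (N.omegaHat Shat l)) (N.H l l) F G δ ν (S l) := by
  obtain ⟨-, F, G, δ, hF, hG, hδ, hH, hc⟩ := h
  have hΩ := omega_posDef hS l
  have hB := omegaHat_posDef hShat l
  exact ⟨F, G, δ, (CFC.sqrt_nonneg _).posSemidef.isHermitian,
    (CFC.sqrt_nonneg _).posSemidef.isHermitian,
    (isUnit_iff_isUnit_det _).mp ((CFC.isUnit_sqrt_iff _ hΩ.posSemidef.nonneg).mpr hΩ.isUnit),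
    (isUnit_iff_isUnit_det _).mp ((CFC.isUnit_sqrt_iff _ hB.posSemidef.nonneg).mpr hB.isUnit),
    hF, hG, hδ, hH, hc⟩

theorem sqrt_omega_mul_self (hS : ∀ l, (S l).PosSemidef) (l : Fin L) :
    CFC.sqrt (N.omega S l) * CFC.sqrt (N.omega S l) = N.omega S l :=
  CFC.sqrt_mul_sqrt_self _ (omega_posDef hS l).posSemidef.nonneg

theorem sqrt_omegaHat_mul_self {Shat : N.RxFamily} (hShat : ∀ l, (Shat l).PosSemidef)
    (l : Fin L) :
    CFC.sqrt (N.omegaHat Shat l) * CFC.sqrt (N.omegaHat Shat l) = N.omegaHat Shat l :=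
  CFC.sqrt_mul_sqrt_self _ (omegaHat_posDef hShat l).posSemidef.nonneg

theorem IsWaterLevel.stationary {Shat : N.RxFamily} (hS : ∀ l, (S l).PosSemidef)
    (hShat : ∀ l, (Shat l).PosSemidef) {l : Fin L} {ν : ℝ} (h : N.IsWaterLevel S Shat l ν) :
    N.omegaHat Shat l * S l = (ν : ℂ) • ((N.H l l).conjTranspose *
      (N.H l l * S l * (N.H l l).conjTranspose + N.omega S l)⁻¹ * N.H l l) * S l := by
  obtain ⟨F, G, δ, hw⟩ := h.exists_isWaterFilling hS hShat
  simpa only [sqrt_omega_mul_self hS, sqrt_omegaHat_mul_self hShat] using hw.stationary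

theorem omegaHat_reverse (N : BMAC L) (S : N.TxFamily) : N.reverse.omegaHat S = N.omega S := by
  funext l
  simp only [omegaHat, omega, reverse, transpose_apply, conjTranspose_conjTranspose]
  rfl

/-- Duality: with the level of each link kept, `S` is the covariance transform in the reverse
network of each decomposition of its own dual. -/
theorem dual_reverse_eq {Shat : N.RxFamily} (hS : ∀ l, (S l).PosSemidef)
    (hpos : ∀ l, (Shat l).PosSemidef) {ν : Fin L → ℝ}
    (hν : ∀ l, N.IsWaterLevel S Shat l (ν l))
    (hShat : ∀ l, Shat l = (ν l : ℂ) • ((N.omega S l)⁻¹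
      - (N.H l l * S l * (N.H l l).conjTranspose + N.omega S l)⁻¹))
    (e : Decomposition N.reverse Shat) : e.dual = S := by
  refine e.dual_eq_of_forall_stationary (ν := ν) hS (fun l => ?_) fun l => ?_
  · obtain ⟨F, G, δ, hw⟩ := (hν l).exists_isWaterFilling hS hpos
    have := hw.cov_eq_reverse_dual (T := Shat l) (by rw [sqrt_omega_mul_self hS]; exact hShat l)
    rw [sqrt_omegaHat_mul_self hpos] at this
    rw [← omegaHat_eq_omega_reverse]
    rw [show (N.reverse.H l l).conjTranspose = N.H l l from conjTranspose_conjTranspose _]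
    exact this
  · obtain ⟨F, G, δ, hw⟩ := (hν l).exists_isWaterFilling hS hpos
    have := hw.reverse.stationary
    rw [sqrt_omega_mul_self hS, ← hShat l, sqrt_omegaHat_mul_self hpos] at this
    rw [← omegaHat_eq_omega_reverse, omegaHat_reverse]
    exact this

end BMAC

theorem mainTheorem4 {L : ℕ} (N : BMAC L) (S : N.TxFamily)
    (hS : N.HasPoliteWaterFilling S) :
    ∃ Shat : N.RxFamily,
      (∀ d : BMAC.Decomposition N S, d.dual = Shat) ∧
      (∀ e : BMAC.Decomposition N.reverse Shat, e.dual = S) ∧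
      (∀ l : Fin L,
        (N.omegaHat Shat l)⁻¹ * (N.H l l).conjTranspose * Shat l * N.H l l
          = S l * (N.H l l).conjTranspose * (N.omega S l)⁻¹ * N.H l l) ∧
      (∀ l : Fin L, (∃ ν : ℝ, N.IsWaterLevel S Shat l ν) ∧
        ∀ ν : ℝ, N.IsWaterLevel S Shat l ν →
          Shat l = (ν : ℂ) • ((N.omega S l)⁻¹
            - (N.H l l * S l * (N.H l l).conjTranspose + N.omega S l)⁻¹)) := by
  obtain ⟨d₀, h₀⟩ := hS
  choose ν hν using h₀
  have hS := d₀.posSemidef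
  have hpos := d₀.dual_posSemidef
  have hdual : ∀ l ν, N.IsWaterLevel S d₀.dual l ν → _ := fun l ν h =>
    d₀.dual_eq_of_stationary (h.stationary hS hpos)
  refine ⟨d₀.dual, fun d => ?_, fun e => ?_, fun l => ?_, fun l => ⟨⟨ν l, hν l⟩, hdual l⟩⟩
  · exact d.dual_eq_of_forall_stationary hpos (fun l => hdual l _ (hν l))
      fun l => (hν l).stationary hS hpos
  · exact BMAC.dual_reverse_eq hS hpos hν (fun l => hdual l _ (hν l)) e
  · obtain ⟨F, G, δ, hw⟩ := (hν l).exists_isWaterFilling hS hpos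
    have := hw.inv_mul_dual_comm (T := d₀.dual l)
      (by rw [BMAC.sqrt_omega_mul_self hS]; exact hdual l _ (hν l))
    rwa [BMAC.sqrt_omega_mul_self hS, BMAC.sqrt_omegaHat_mul_self hpos] at this
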